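/- Let $P_1,P_2,N_1,N_2>0$, $a_{12}\ge N_1/N_2$ and $a_{21}\ge N_2/N_1$. For $Q_1,Q_2>0$ consider the two-user additive state-dependent Gaussian interference channel, whose outputs over a block of length $n$ are $$\boldsymbol Y_1=\boldsymbol X_1+\sqrt{a_{12}}\,\boldsymbol X_2+\boldsymbol S_1+\sqrt{a_{12}}\,\boldsymbol S_2+\boldsymbol Z_1,\qquad \boldsymbol Y_2=\sqrt{a_{21}}\,\boldsymbol X_1+\boldsymbol X_2+\sqrt{a_{21}}\,\boldsymbol S_1+\boldsymbol S_2+\boldsymbol Z_2,$$ where $\boldsymbol S_1,\boldsymbol S_2,\boldsymbol Z_1,\boldsymbol Z_2$ are independent and $\boldsymbol S_i$, $\boldsymbol Z_i$ have i.i.d. coordinates distributed as $\mathcal N(0,Q_i)$ and $\mathcal N(0,N_i)$. The messages $W_1,W_2$ are independent of each other and of the states and noises, and $W_i$ is uniform on a set of $\lceil 2^{nR_i}\rceil$ elements. Encoder $i$ produces $\boldsymbol X_i$ as a function of $W_i$ and of the whole sequence $\boldsymbol S_i$, subject to $\frac1n\sum_{j=1}^n\mathbb E|X_i[j]|^2\le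 P_i$; decoder $i$ produces an estimate $\hat W_i$ as a function of $\boldsymbol Y_i$ alone. A pair $(R_1,R_2)$ of nonnegative reals is achievable if there is a sequence of such codes, one for each length $n$, with $\Pr\{\hat W_1\ne W_1\text{ or }\hat W_2\ne W_2\}\to0$ as $n\to\infty$; the capacity region $\mathcal C(Q_1,Q_2)$ is the closure of the set of achievable pairs. In the limit $Q_1,Q_2\to\infty$ the capacity region is contained in the region of pairs $R_1,R_2\ge0$ with $$R_1+R_2\le B:=\min\left(\tfrac12\log_2\left(1+\tfrac{a_{12}P_2}{N_1}\right),\ \tfrac12\log_2\left(1+\tfrac{a_{21}P_1}{N_2}\right)\right).$$ That is: every limit point of pairs $(R_1,R_2)\in\mathcal C(Q_1,Q_2)$ as $Q_1,Q_2\to\infty$ satisfies $R_1,R_2\ge 0$ and $R_1+R_2\le B$; and, uniformly, for every $\varepsilon>0$ there is $Q_0$ such that for all $Q_1,Q_2\ge Q_0$ every $(R_1,R_2)\in\mathcal C(Q_1,Q_2)$ satisfies $R_1,R_2\ge0$ and $R_1+R_2\le B+\varepsilon$. -/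

import Mathlib

open MeasureTheory ProbabilityTheory Filter Topology

noncomputable section

/-- Parameters of the two-user additive state-dependent Gaussian interference channel:
interference gains `a12`, `a21`, input powers `P1`, `P2`, noise variances `N1`, `N2`
and state variances `Q1`, `Q2`. -/
structure ASDGIC where
  a12 : ℝ
  a21 : ℝ
  P1 : ℝ
  P2 : ℝ
  N1 : ℝ
  N2 : ℝ
  Q1 : ℝ
  Q2 : ℝ

namespace ASDGIC

/-- Law of a vector of `n` i.i.d. centred Gaussian variables of variance `v`. -/
def iidGaussian (n : ℕ) (v : ℝ) : Measure (Fin n → ℝ) :=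
  Measure.pi fun _ => gaussianReal 0 v.toNNReal

/-- Joint law of `((S₁, S₂), (Z₁, Z₂))`: independent states and independent noises. -/
def law (c : ASDGIC) (n : ℕ) :
    Measure (((Fin n → ℝ) × (Fin n → ℝ)) × ((Fin n → ℝ) × (Fin n → ℝ))) :=
  ((iidGaussian n c.Q1).prod (iidGaussian n c.Q2)).prod
    ((iidGaussian n c.N1).prod (iidGaussian n c.N2))

/-- Output at receiver 1: `Y₁ = X₁ + √a₁₂ X₂ + S₁ + √a₁₂ S₂ + Z₁`. -/
def output1 (c : ASDGIC) {n : ℕ} (x1 x2 s1 s2 z1 : Fin n → ℝ) : Fin n → ℝ :=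
  x1 + √c.a12 • x2 + s1 + √c.a12 • s2 + z1

/-- Output at receiver 2: `Y₂ = √a₂₁ X₁ + X₂ + √a₂₁ S₁ + S₂ + Z₂`. -/
def output2 (c : ASDGIC) {n : ℕ} (x1 x2 s1 s2 z2 : Fin n → ℝ) : Fin n → ℝ :=
  √c.a21 • x1 + x2 + √c.a21 • s1 + s2 + z2

/-- A block code of length `n` with `M1` and `M2` messages. Encoder `i` sees its message and
the whole state sequence `Sᵢ`; decoder `i` sees only the output sequence `Yᵢ`. -/
structure Code (n M1 M2 : ℕ) where
  enc1 : Fin M1 → (Fin n → ℝ) → (Fin n → ℝ)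
  enc2 : Fin M2 → (Fin n → ℝ) → (Fin n → ℝ)
  dec1 : (Fin n → ℝ) → Fin M1
  dec2 : (Fin n → ℝ) → Fin M2
  measurable_enc1 : ∀ w, Measurable (enc1 w)
  measurable_enc2 : ∀ w, Measurable (enc2 w)
  measurable_dec1 : Measurable dec1
  measurable_dec2 : Measurable dec2

/-- `(1/n) ∑ⱼ E |X[j]|² ≤ P` for `X = enc W S`, where `W` is uniform on the `M` messages and
`S` is an independent i.i.d. Gaussian state of variance `Q`. -/
def PowerLimited {n M : ℕ} (enc : Fin M → (Fin n → ℝ) → (Fin n → ℝ)) (Q P : ℝ) : Prop :=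
  (∀ w j, Integrable (fun s => (enc w s j) ^ 2) (iidGaussian n Q)) ∧
    (1 / (n : ℝ)) * ∑ j, (1 / (M : ℝ)) * ∑ w, ∫ s, (enc w s j) ^ 2 ∂(iidGaussian n Q) ≤ P

/-- The event that at least one receiver decodes its message wrongly when `(w1, w2)` is sent. -/
def errorEvent (c : ASDGIC) {n M1 M2 : ℕ} (C : Code n M1 M2) (w1 : Fin M1) (w2 : Fin M2) :
    Set (((Fin n → ℝ) × (Fin n → ℝ)) × ((Fin n → ℝ) × (Fin n → ℝ))) :=
  {ω | C.dec1 (c.output1 (C.enc1 w1 ω.1.1) (C.enc2 w2 ω.1.2) ω.1.1 ω.1.2 ω.2.1) ≠ w1 ∨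
       C.dec2 (c.output2 (C.enc1 w1 ω.1.1) (C.enc2 w2 ω.1.2) ω.1.1 ω.1.2 ω.2.2) ≠ w2}

/-- Average error probability, the message pair being uniform. -/
def errorProb (c : ASDGIC) {n M1 M2 : ℕ} (C : Code n M1 M2) : ℝ :=
  (1 / ((M1 : ℝ) * M2)) * ∑ w1, ∑ w2, (c.law n).real (c.errorEvent C w1 w2)

/-- Number of messages `⌈2 ^ (n R)⌉` of a code of length `n` and rate `R`. -/
def numMessages (n : ℕ) (R : ℝ) : ℕ := ⌈(2 : ℝ) ^ ((n : ℝ) * R)⌉₊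

/-- Achievability of a pair of (nonnegative) rates. -/
def Achievable (c : ASDGIC) (R : ℝ × ℝ) : Prop :=
  0 ≤ R.1 ∧ 0 ≤ R.2 ∧
    ∃ C : ∀ n : ℕ, Code n (numMessages n R.1) (numMessages n R.2),
      (∀ n, PowerLimited (C n).enc1 c.Q1 c.P1 ∧ PowerLimited (C n).enc2 c.Q2 c.P2) ∧
      Tendsto (fun n => c.errorProb (C n)) atTop (𝓝 0)

/-- The capacity region: the closure of the set of achievable rate pairs. -/
def capacityRegion (c : ASDGIC) : Set (ℝ × ℝ) :=
  closure {R | c.Achievable R}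

/-- The limit (Kuratowski upper limit) of the capacity region as `Q₁, Q₂ → ∞`: all rate pairs
that are limit points of points of the capacity regions along state variances tending to
infinity. -/
def limitCapacityRegion (a12 a21 P1 P2 N1 N2 : ℝ) : Set (ℝ × ℝ) :=
  {R | ∀ U ∈ 𝓝 R, ∃ᶠ Q : ℝ × ℝ in atTop ×ˢ atTop,
    (capacityRegion ⟨a12, a21, P1, P2, N1, N2, Q.1, Q.2⟩ ∩ U).Nonempty}

/-- The bound `min (½ log₂ (1 + a₁₂P₂/N₁)) (½ log₂ (1 + a₂₁P₁/N₂))` on the sum rate. -/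
def sumRateBound (a12 a21 P1 P2 N1 N2 : ℝ) : ℝ :=
  min (1 / 2 * Real.logb 2 (1 + a12 * P2 / N1)) (1 / 2 * Real.logb 2 (1 + a21 * P1 / N2))

/-- Pairs of nonnegative rates whose sum is at most `B`. -/
def sumRateRegion (B : ℝ) : Set (ℝ × ℝ) :=
  {R | 0 ≤ R.1 ∧ 0 ≤ R.2 ∧ R.1 + R.2 ≤ B}

end ASDGIC

end

noncomputable section

namespace ASDGIC

/-! Let receiver 1 also know `S₁`; with `α = √a₁₂`, it then has `Y = X₁ + α (X₂ + S₂) + Z₁`.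
Decoding `W₁` reveals `X₁`, hence `X₂ + S₂ + Z₁ / α`. As `N₁ / a₁₂ ≤ N₂`, adding `√a₂₁ (X₁ + S₁)`
and independent noise `V` of variance `N₂ - N₁ / a₁₂` gives a vector distributed like `Y₂`, from
which `W₂` is decoded too. So one receiver recovers both messages, and the sum rate is bounded by
the information that `Y` carries.

Per letter that is at most about `½ log (T σ / (Q₂ N₁))`, where `T ≈ a₁₂ Q₂` bounds the power of `Y`
and `σ = P₂ + N₁ / a₁₂` that of the error in estimating `S₂` by `(Y - X₁) / α`. As `Q₂ → ∞` this
tends to `½ log (1 + a₁₂ P₂ / N₁)`. The strong state thus uses up the range of `Y`. Exchanging the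
users gives the other bound.

No mutual information is used. The true law is compared with one under which `(S₁, V, Y)` is a
product law independent of the messages, so that disjoint decoding regions have total mass at most 1
(`lintegral_mul_exp_neg_logRatio`, `sum_log_mul_measureReal_le`). The price is the mean
log-likelihood ratio, which needs second moments only (`integral_logRatio_le`). The simulation of
`Y₂` is `one_sub_two_mul_measureReal_errorEvent_le`. -/

instance instIsProbabilityMeasureIidGaussian (n : ℕ) (v : ℝ) :
    IsProbabilityMeasure (iidGaussian n v) := by
  unfold iidGaussian; infer_instance

/-! ### Gaussian densities and the change of measure -/

/-- Logarithm of the density of `n` i.i.d. centred Gaussian variables of variance `v`. -/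
def logDensity {n : ℕ} (v : ℝ) (x : Fin n → ℝ) : ℝ :=
  -((n : ℝ) / 2 * Real.log (2 * Real.pi * v)) - (∑ i, x i ^ 2) / (2 * v)

@[fun_prop]
lemma measurable_logDensity {n : ℕ} (v : ℝ) : Measurable (logDensity (n := n) v) := by
  unfold logDensity; fun_prop

lemma prod_gaussianPDFReal_eq_exp_logDensity {n : ℕ} {v : ℝ} (hv : 0 < v) (x : Fin n → ℝ) :
    ∏ i, gaussianPDFReal 0 v.toNNReal (x i) = Real.exp (logDensity v x) := by
  have h2 : (0 : ℝ) < 2 * Real.pi * v := by positivity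
  have h (t : ℝ) : gaussianPDFReal 0 v.toNNReal t =
      Real.exp (-(1 / 2 * Real.log (2 * Real.pi * v)) - t ^ 2 / (2 * v)) := by
    rw [gaussianPDFReal, Real.coe_toNNReal _ hv.le, sub_eq_add_neg (-(1 / 2 * _)), Real.exp_add,
      Real.exp_neg, sub_zero, neg_div]
    congr 2
    rw [Real.sqrt_eq_rpow, Real.rpow_def_of_pos h2, mul_comm]
  simp_rw [h, ← Real.exp_sum, Finset.sum_sub_distrib, logDensity, Finset.sum_div]
  simp only [Finset.sum_const, Finset.card_univ, Fintype.card_fin, nsmul_eq_mul]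
  congr 2
  ring

/-- A product measure is determined by its values on boxes, and on a box the density times the
indicator factors over the coordinates. -/
lemma iidGaussian_eq_withDensity (n : ℕ) {v : ℝ} (hv : 0 < v) :
    iidGaussian n v =
      volume.withDensity fun x => ENNReal.ofReal (Real.exp (logDensity v x)) := by
  have hv' : v.toNNReal ≠ 0 := by simpa using hv
  refine Measure.pi_eq fun s hs => ?_
  have hg (i : Fin n) : Integrable ((s i).indicator (gaussianPDFReal 0 v.toNNReal)) :=
    (integrable_gaussianPDFReal _ _).indicator (hs i)
  have h0 (i : Fin n) (t : ℝ) : 0 ≤ (s i).indicator (gaussianPDFReal 0 v.toNNReal) t :=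
    Set.indicator_nonneg (fun _ _ => gaussianPDFReal_nonneg _ _ _) _
  have hind (x : Fin n → ℝ) :
      (Set.univ.pi s).indicator (fun x => ENNReal.ofReal (Real.exp (logDensity v x))) x =
        ENNReal.ofReal (∏ i, (s i).indicator (gaussianPDFReal 0 v.toNNReal) (x i)) := by
    by_cases hx : x ∈ Set.univ.pi s
    · rw [Set.indicator_of_mem hx, ← prod_gaussianPDFReal_eq_exp_logDensity hv]
      congr 1
      exact Finset.prod_congr rfl fun i _ => (Set.indicator_of_mem (hx i trivial) _).symm
    · rw [Set.indicator_of_notMem hx]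
      obtain ⟨i, hi⟩ : ∃ i, x i ∉ s i := by simpa [Set.mem_pi] using hx
      rw [Finset.prod_eq_zero (Finset.mem_univ i) (Set.indicator_of_notMem hi _)]
      simp
  rw [withDensity_apply _ (MeasurableSet.univ_pi hs),
    ← lintegral_indicator (MeasurableSet.univ_pi hs)]
  simp_rw [hind]
  rw [volume_pi, ← ofReal_integral_eq_lintegral_ofReal (Integrable.fintype_prod hg)
    (ae_of_all _ fun x => Finset.prod_nonneg fun i _ => h0 i _), integral_fintype_prod_eq_prod,
    ENNReal.ofReal_prod_of_nonneg fun i _ => integral_nonneg (h0 i)]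
  refine Finset.prod_congr rfl fun i _ => ?_
  rw [gaussianReal_apply_eq_integral _ hv', integral_indicator (hs i)]

lemma lintegral_iidGaussian {n : ℕ} {v : ℝ} (hv : 0 < v) {f : (Fin n → ℝ) → ENNReal}
    (hf : Measurable f) :
    ∫⁻ x, f x ∂iidGaussian n v =
      ∫⁻ x, ENNReal.ofReal (Real.exp (logDensity v x)) * f x := by
  rw [iidGaussian_eq_withDensity n hv, lintegral_withDensity_eq_lintegral_mul _ (by fun_prop) hf]
  rfl

lemma lintegral_exp_logDensity (n : ℕ) {v : ℝ} (hv : 0 < v) :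
    ∫⁻ x : Fin n → ℝ, ENNReal.ofReal (Real.exp (logDensity v x)) = 1 := by
  simpa using (lintegral_iidGaussian (n := n) hv (f := fun _ => 1) measurable_const).symm

/-- Change of measure: let `S` and `Z` be independent i.i.d. Gaussian vectors and `Y = m S + Z`.
Weighting by the likelihood ratio of the law under which `Y` is i.i.d. Gaussian of variance `T`
and `S`, given `Y`, is i.i.d. Gaussian of variance `σ` around `g Y`, to the true law of `(S, Y)`,
turns the law of `Y` into the Gaussian one. -/
lemma lintegral_lintegral_exp_logDensity {n : ℕ} {Q N T σ : ℝ} (hQ : 0 < Q) (hN : 0 < N)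
    (hT : 0 < T) (hσ : 0 < σ) {m g : (Fin n → ℝ) → (Fin n → ℝ)}
    (hg : Measurable g) {F : (Fin n → ℝ) → ENNReal} (hF : Measurable F) :
    ∫⁻ s, ∫⁻ z, F (m s + z) * ENNReal.ofReal (Real.exp (-(logDensity Q s + logDensity N z -
        logDensity T (m s + z) - logDensity σ (s - g (m s + z)))))
        ∂iidGaussian n N ∂iidGaussian n Q = ∫⁻ y, F y ∂iidGaussian n T := by
  have hinner (s : Fin n → ℝ) :
      ∫⁻ z, F (m s + z) * ENNReal.ofReal (Real.exp (-(logDensity Q s + logDensity N z -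
        logDensity T (m s + z) - logDensity σ (s - g (m s + z))))) ∂iidGaussian n N =
      ∫⁻ y, F y * ENNReal.ofReal (Real.exp (-logDensity Q s + logDensity T y +
        logDensity σ (s - g y))) := by
    rw [lintegral_iidGaussian hN (by fun_prop)]
    -- For fixed `s`, translation by `m s` turns the integral over `z` into one over `y = m s + z`;
    -- the density of `z` cancels.
    rw [← lintegral_add_left_eq_self (μ := volume) (fun y => F y * ENNReal.ofReal
      (Real.exp (-logDensity Q s + logDensity T y + logDensity σ (s - g y)))) (m s)]
    refine lintegral_congr fun z => ?_
    rw [mul_left_comm, ← ENNReal.ofReal_mul (Real.exp_nonneg _), ← Real.exp_add]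
    congr 3
    ring
  simp_rw [hinner]
  rw [lintegral_iidGaussian hQ
    (Measurable.lintegral_prod_right' (f := fun p : (Fin n → ℝ) × (Fin n → ℝ) =>
      F p.2 * ENNReal.ofReal (Real.exp (-logDensity Q p.1 + logDensity T p.2 +
        logDensity σ (p.1 - g p.2)))) (by fun_prop)), lintegral_iidGaussian hT hF]
  have hpull (s : Fin n → ℝ) :
      ENNReal.ofReal (Real.exp (logDensity Q s)) *
        ∫⁻ y, F y * ENNReal.ofReal (Real.exp (-logDensity Q s + logDensity T y +
          logDensity σ (s - g y))) =
      ∫⁻ y, ENNReal.ofReal (Real.exp (logDensity T y)) * F y *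
        ENNReal.ofReal (Real.exp (logDensity σ (s - g y))) := by
    rw [← lintegral_const_mul _ (by fun_prop)]
    refine lintegral_congr fun y => ?_
    rw [mul_left_comm, ← ENNReal.ofReal_mul (Real.exp_nonneg _), ← Real.exp_add,
      mul_right_comm, ← ENNReal.ofReal_mul (Real.exp_nonneg _), ← Real.exp_add, mul_comm]
    congr 3
    ring
  simp_rw [hpull]
  -- With `y` fixed first, the remaining `s`-integral is that of a Gaussian density centred at `g
  -- y`, of mass 1.
  rw [lintegral_lintegral_swap (Measurable.aemeasurable (by fun_prop))]
  refine lintegral_congr fun y => ?_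
  rw [lintegral_const_mul _ (by fun_prop),
    lintegral_sub_right_eq_self (fun s => ENNReal.ofReal (Real.exp (logDensity σ s))) (g y),
    lintegral_exp_logDensity n hσ, mul_one]

/-! ### Gaussian moments and noise splitting -/

lemma measurePreserving_eval_iidGaussian {n : ℕ} (v : ℝ) (i : Fin n) :
    MeasurePreserving (fun x : Fin n → ℝ => x i) (iidGaussian n v)
      (gaussianReal 0 v.toNNReal) :=
  measurePreserving_eval _ i

lemma memLp_eval_iidGaussian {n : ℕ} (v : ℝ) (i : Fin n) :
    MemLp (fun x : Fin n → ℝ => x i) 2 (iidGaussian n v) :=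
  (memLp_id_gaussianReal' 2 (by simp)).comp_measurePreserving
    (measurePreserving_eval_iidGaussian v i)

lemma integral_eval_iidGaussian {n : ℕ} (v : ℝ) (i : Fin n) :
    ∫ x, x i ∂iidGaussian n v = 0 :=
  (integral_comp_eval (μ := fun _ : Fin n => gaussianReal 0 v.toNNReal) (f := fun t : ℝ => t)
    (by fun_prop)).trans integral_id_gaussianReal

lemma integral_sq_eval_iidGaussian {n : ℕ} {v : ℝ} (hv : 0 ≤ v) (i : Fin n) :
    ∫ x, x i ^ 2 ∂iidGaussian n v = v := by
  refine (integral_comp_eval (μ := fun _ : Fin n => gaussianReal 0 v.toNNReal)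
    (f := fun t : ℝ => t ^ 2) (by fun_prop)).trans ?_
  have h := variance_fun_id_gaussianReal (μ := 0) (v := v.toNNReal)
  rw [variance_of_integral_eq_zero (by fun_prop) integral_id_gaussianReal,
    Real.coe_toNNReal _ hv] at h
  exact h

/-- `Z / α + V` is i.i.d. Gaussian of variance `N'` if `Z` has variance `N` and the independent
vector `V` has variance `N' - N / α²`. -/
lemma measurePreserving_smul_add_iidGaussian (n : ℕ) {α N N' : ℝ} (hN : 0 ≤ N)
    (h : N / α ^ 2 ≤ N') :
    MeasurePreserving (fun p : (Fin n → ℝ) × (Fin n → ℝ) => α⁻¹ • p.1 + p.2)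
      ((iidGaussian n N).prod (iidGaussian n (N' - N / α ^ 2))) (iidGaussian n N') := by
  have h1 : MeasurePreserving (fun p : ℝ × ℝ => α⁻¹ * p.1 + p.2)
      ((gaussianReal 0 N.toNNReal).prod (gaussianReal 0 (N' - N / α ^ 2).toNNReal))
      (gaussianReal 0 N'.toNNReal) := by
    have ha : MeasurePreserving (fun z : ℝ => α⁻¹ * z) (gaussianReal 0 N.toNNReal)
        (gaussianReal 0 (N / α ^ 2).toNNReal) := by
      refine ⟨by fun_prop, ?_⟩
      rw [gaussianReal_map_const_mul, mul_zero]
      congr 1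
      rw [← NNReal.coe_inj]
      have : 0 ≤ N / α ^ 2 := by positivity
      rw [NNReal.coe_mul, Real.coe_toNNReal _ hN, Real.coe_toNNReal _ this, NNReal.coe_mk]
      ring
    have hb : MeasurePreserving (fun p : ℝ × ℝ => p.1 + p.2)
        ((gaussianReal 0 (N / α ^ 2).toNNReal).prod (gaussianReal 0 (N' - N / α ^ 2).toNNReal))
        (gaussianReal 0 N'.toNNReal) := by
      refine ⟨by fun_prop, ?_⟩
      have := gaussianReal_conv_gaussianReal (m₁ := 0) (m₂ := 0) (v₁ := (N / α ^ 2).toNNReal)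
        (v₂ := (N' - N / α ^ 2).toNNReal)
      rw [Measure.conv, add_zero, ← Real.toNNReal_add (by positivity) (by linarith)] at this
      rw [this]
      congr 2
      ring
    exact hb.comp (ha.prod (MeasurePreserving.id _))
  have h2 := measurePreserving_pi (fun _ : Fin n => (gaussianReal 0 N.toNNReal).prod
    (gaussianReal 0 (N' - N / α ^ 2).toNNReal)) (fun _ : Fin n => gaussianReal 0 N'.toNNReal)
    fun _ => h1
  exact h2.comp (measurePreserving_arrowProdEquivProdArrow ℝ ℝ (Fin n)
    (fun _ => gaussianReal 0 N.toNNReal)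
    (fun _ => gaussianReal 0 (N' - N / α ^ 2).toNNReal)).symm

lemma ofReal_integral_le_lintegral_ofReal {Ω : Type*} [MeasurableSpace Ω] {μ : Measure Ω}
    {f : Ω → ℝ} (hf : Integrable f μ) :
    ENNReal.ofReal (∫ ω, f ω ∂μ) ≤ ∫⁻ ω, ENNReal.ofReal (f ω) ∂μ := by
  have h := hf.pos_part
  calc ENNReal.ofReal (∫ ω, f ω ∂μ) ≤ ENNReal.ofReal (∫ ω, max (f ω) 0 ∂μ) :=
        ENNReal.ofReal_le_ofReal (integral_mono hf h fun ω => le_max_left _ _)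
    _ = ∫⁻ ω, ENNReal.ofReal (f ω) ∂μ := by
        rw [ofReal_integral_eq_lintegral_ofReal h (ae_of_all _ fun ω => le_max_right _ _)]
        simp

/-! ### Converse for disjoint decoding regions -/

variable {n : ℕ}

/-- Law of `((S₁, S₂), (Z, V))` with `V` an auxiliary noise of variance `v`. -/
def coupledLaw (n : ℕ) (Q1 Q2 N v : ℝ) :
    Measure (((Fin n → ℝ) × (Fin n → ℝ)) × ((Fin n → ℝ) × (Fin n → ℝ))) :=
  ((iidGaussian n Q1).prod (iidGaussian n Q2)).prod ((iidGaussian n N).prod (iidGaussian n v))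

instance instIsProbabilityMeasureCoupledLaw (n : ℕ) (Q1 Q2 N v : ℝ) :
    IsProbabilityMeasure (coupledLaw n Q1 Q2 N v) := by
  unfold coupledLaw; infer_instance

/-- The output `X₁ + α (X₂ + S₂) + Z` left when the first state is removed. -/
def reducedOutput (α : ℝ) (x1 x2 : (Fin n → ℝ) → (Fin n → ℝ))
    (ω : ((Fin n → ℝ) × (Fin n → ℝ)) × ((Fin n → ℝ) × (Fin n → ℝ))) : Fin n → ℝ :=
  x1 ω.1.1 + α • (x2 ω.1.2 + ω.1.2) + ω.2.1

/-- Log-likelihood ratio between the true law of `(S₂, Y)` given `S₁`, where `Y` is the reduced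
output, and the law under which `Y` has variance `T` and `S₂` has, given `Y`, mean
`(Y - X₁) / α` and variance `σ`. -/
def logRatio (α Q2 N T σ : ℝ) (x1 x2 : (Fin n → ℝ) → (Fin n → ℝ))
    (ω : ((Fin n → ℝ) × (Fin n → ℝ)) × ((Fin n → ℝ) × (Fin n → ℝ))) : ℝ :=
  logDensity Q2 ω.1.2 + logDensity N ω.2.1 - logDensity T (reducedOutput α x1 x2 ω) -
    logDensity σ (ω.1.2 - α⁻¹ • (reducedOutput α x1 x2 ω - x1 ω.1.1))

@[fun_prop]
lemma measurable_reducedOutput {α : ℝ} {x1 x2 : (Fin n → ℝ) → (Fin n → ℝ)}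
    (h1 : Measurable x1) (h2 : Measurable x2) : Measurable (reducedOutput α x1 x2) := by
  unfold reducedOutput; fun_prop

@[fun_prop]
lemma measurable_logRatio {α Q2 N T σ : ℝ} {x1 x2 : (Fin n → ℝ) → (Fin n → ℝ)}
    (h1 : Measurable x1) (h2 : Measurable x2) : Measurable (logRatio α Q2 N T σ x1 x2) := by
  unfold logRatio; fun_prop

/-- Fixing `s₁` and `v` reduces this to `lintegral_lintegral_exp_logDensity`. The resulting law does
not involve the encoders, which is what makes the bound uniform in the messages. -/
lemma lintegral_mul_exp_neg_logRatio {α Q1 Q2 N v T σ : ℝ} (hQ2 : 0 < Q2) (hN : 0 < N)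
    (hT : 0 < T) (hσ : 0 < σ) {x1 x2 : (Fin n → ℝ) → (Fin n → ℝ)} (h1 : Measurable x1)
    (h2 : Measurable x2) {F : (Fin n → ℝ) × (Fin n → ℝ) × (Fin n → ℝ) → ENNReal}
    (hF : Measurable F) :
    ∫⁻ ω, F (ω.1.1, ω.2.2, reducedOutput α x1 x2 ω) *
        ENNReal.ofReal (Real.exp (-logRatio α Q2 N T σ x1 x2 ω)) ∂coupledLaw n Q1 Q2 N v =
      ∫⁻ p, F p ∂(iidGaussian n Q1).prod ((iidGaussian n v).prod (iidGaussian n T)) := by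
  rw [coupledLaw, lintegral_prod _ (Measurable.aemeasurable (by fun_prop)),
    lintegral_prod _ (Measurable.lintegral_prod_right' (f := fun ω =>
      F (ω.1.1, ω.2.2, reducedOutput α x1 x2 ω) *
        ENNReal.ofReal (Real.exp (-logRatio α Q2 N T σ x1 x2 ω))) (by fun_prop)).aemeasurable,
    lintegral_prod _ hF.aemeasurable]
  refine lintegral_congr fun s1 => ?_
  rw [lintegral_prod _ (Measurable.aemeasurable (by fun_prop))]
  -- The auxiliary noise is integrated outside `z`, then moved outside `s₂`, leaving the pair `(s₂,
  -- z)` innermost.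
  have hinner (s2 : Fin n → ℝ) := lintegral_prod_symm (μ := iidGaussian n N)
    (ν := iidGaussian n v) (fun q : (Fin n → ℝ) × (Fin n → ℝ) =>
      F (s1, q.2, reducedOutput α x1 x2 ((s1, s2), q)) *
        ENNReal.ofReal (Real.exp (-logRatio α Q2 N T σ x1 x2 ((s1, s2), q))))
      (Measurable.aemeasurable (by fun_prop))
  simp only [hinner]
  rw [lintegral_lintegral_swap]
  · refine lintegral_congr fun u => ?_
    exact lintegral_lintegral_exp_logDensity hQ2 hN hT hσ
      (m := fun s => x1 s1 + α • (x2 s + s)) (g := fun y => α⁻¹ • (y - x1 s1)) (by fun_prop)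
      (F := fun y => F (s1, u, y)) (by fun_prop)
  · exact (Measurable.lintegral_prod_left' (f := fun r : (Fin n → ℝ) × ((Fin n → ℝ) × (Fin n → ℝ)) =>
      F (s1, r.2.2, reducedOutput α x1 x2 ((s1, r.2.1), (r.1, r.2.2))) *
        ENNReal.ofReal (Real.exp (-logRatio α Q2 N T σ x1 x2 ((s1, r.2.1), (r.1, r.2.2)))))
      (by fun_prop)).aemeasurable

/-- For a single message pair: the change of measure combined with `x + 1 ≤ exp x`. -/
lemma ofReal_log_mul_measureReal_sub_integral_logRatio_le {α Q1 Q2 N v T σ M : ℝ}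
    (hQ2 : 0 < Q2) (hN : 0 < N) (hT : 0 < T) (hσ : 0 < σ) (hM : 0 < M)
    {x1 x2 : (Fin n → ℝ) → (Fin n → ℝ)} (h1 : Measurable x1) (h2 : Measurable x2)
    (hint : Integrable (logRatio α Q2 N T σ x1 x2) (coupledLaw n Q1 Q2 N v))
    {A : Set ((Fin n → ℝ) × (Fin n → ℝ) × (Fin n → ℝ))} (hA : MeasurableSet A) :
    ENNReal.ofReal (Real.log M * (coupledLaw n Q1 Q2 N v).real
        {ω | (ω.1.1, ω.2.2, reducedOutput α x1 x2 ω) ∈ A} -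
      ∫ ω, logRatio α Q2 N T σ x1 x2 ω ∂coupledLaw n Q1 Q2 N v + 1) ≤
    1 + ENNReal.ofReal M *
      (iidGaussian n Q1).prod ((iidGaussian n v).prod (iidGaussian n T)) A := by
  set μ := coupledLaw n Q1 Q2 N v
  set ℓ := logRatio α Q2 N T σ x1 x2
  set B := {ω | (ω.1.1, ω.2.2, reducedOutput α x1 x2 ω) ∈ A}
  have hB : MeasurableSet B := measurableSet_preimage (by fun_prop) hA
  have hBi : Integrable (B.indicator fun _ => Real.log M) μ :=
    (integrable_const _).indicator hB
  have hint' : Integrable (fun ω => B.indicator (fun _ => Real.log M) ω - ℓ ω + 1) μ :=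
    (hBi.sub hint).add (integrable_const _)
  have heq : Real.log M * μ.real B - ∫ ω, ℓ ω ∂μ + 1 =
      ∫ ω, (B.indicator (fun _ => Real.log M) ω - ℓ ω + 1) ∂μ := by
    have hadd : ∫ ω, (B.indicator (fun _ => Real.log M) ω - ℓ ω + 1) ∂μ =
        ∫ ω, (B.indicator (fun _ => Real.log M) ω - ℓ ω) ∂μ + ∫ _, (1 : ℝ) ∂μ :=
      integral_add (hBi.sub hint) (integrable_const _)
    rw [hadd, integral_sub hBi hint, integral_indicator hB]
    simp [mul_comm]
  rw [heq]
  refine (ofReal_integral_le_lintegral_ofReal hint').trans ?_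
  have hF : Measurable fun p => 1 + A.indicator (fun _ => ENNReal.ofReal M) p :=
    (measurable_const.indicator hA).const_add 1
  have hcm := lintegral_mul_exp_neg_logRatio (α := α) (Q1 := Q1) (v := v) hQ2 hN hT hσ h1 h2 hF
  rw [lintegral_add_left measurable_const, lintegral_indicator hA] at hcm
  simp only [lintegral_const, measure_univ, mul_one, Measure.restrict_apply_univ]
    at hcm
  rw [← hcm]
  refine lintegral_mono fun ω => ?_
  -- On `B` the exponential is `M * exp (-ℓ)`, off `B` it is `exp (-ℓ)`; both are at most `(1 + M
  -- 1_A) * exp (-ℓ)`, whose integral the change of measure evaluates.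
  have hexp := Real.add_one_le_exp (B.indicator (fun _ => Real.log M) ω - ℓ ω)
  by_cases hω : ω ∈ B
  · have hω' : (ω.1.1, ω.2.2, reducedOutput α x1 x2 ω) ∈ A := hω
    simp only [Set.indicator_of_mem hω, Set.indicator_of_mem hω'] at hexp ⊢
    rw [sub_eq_add_neg, Real.exp_add, Real.exp_log hM] at hexp
    calc _ ≤ ENNReal.ofReal (M * Real.exp (-ℓ ω)) := ENNReal.ofReal_le_ofReal (by linarith)
      _ = ENNReal.ofReal M * ENNReal.ofReal (Real.exp (-ℓ ω)) := ENNReal.ofReal_mul hM.le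
      _ ≤ _ := by gcongr; exact le_add_self
  · have hω' : (ω.1.1, ω.2.2, reducedOutput α x1 x2 ω) ∉ A := hω
    simp only [Set.indicator_of_notMem hω, Set.indicator_of_notMem hω'] at hexp ⊢
    rw [zero_sub] at hexp ⊢
    simpa using ENNReal.ofReal_le_ofReal hexp

/-- Converse for a family of disjoint decoding regions, in terms of the mean log-likelihood
ratio. -/
lemma sum_log_mul_measureReal_le {ι : Type*} [Fintype ι] [Nonempty ι] {α Q1 Q2 N v T σ : ℝ}
    (hQ2 : 0 < Q2) (hN : 0 < N) (hT : 0 < T) (hσ : 0 < σ)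
    {x1 x2 : ι → (Fin n → ℝ) → (Fin n → ℝ)} (h1 : ∀ w, Measurable (x1 w))
    (h2 : ∀ w, Measurable (x2 w))
    (hint : ∀ w, Integrable (logRatio α Q2 N T σ (x1 w) (x2 w)) (coupledLaw n Q1 Q2 N v))
    {A : ι → Set ((Fin n → ℝ) × (Fin n → ℝ) × (Fin n → ℝ))} (hA : ∀ w, MeasurableSet (A w))
    (hdisj : Pairwise (Function.onFun Disjoint A)) :
    Real.log (Fintype.card ι) * ∑ w, (coupledLaw n Q1 Q2 N v).real
        {ω | (ω.1.1, ω.2.2, reducedOutput α (x1 w) (x2 w) ω) ∈ A w} ≤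
      ∑ w, ∫ ω, logRatio α Q2 N T σ (x1 w) (x2 w) ω ∂coupledLaw n Q1 Q2 N v +
        Fintype.card ι := by
  have hM : (0 : ℝ) < Fintype.card ι := by exact_mod_cast Fintype.card_pos
  have hsum := Finset.sum_le_sum fun w (_ : w ∈ Finset.univ) =>
    ofReal_log_mul_measureReal_sub_integral_logRatio_le hQ2 hN hT hσ hM (h1 w) (h2 w)
      (hint w) (hA w)
  have hone : ∑ w, (iidGaussian n Q1).prod ((iidGaussian n v).prod (iidGaussian n T)) (A w)
      ≤ 1 := by
    rw [← tsum_fintype (L := .unconditional ι), ← measure_iUnion hdisj hA]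
    exact prob_le_one
  have hright : ∑ w, (1 + ENNReal.ofReal (Fintype.card ι) *
      (iidGaussian n Q1).prod ((iidGaussian n v).prod (iidGaussian n T)) (A w)) ≤
      ENNReal.ofReal (2 * Fintype.card ι) := by
    rw [Finset.sum_add_distrib, ← Finset.mul_sum]
    calc _ ≤ ∑ _w : ι, (1 : ENNReal) + ENNReal.ofReal (Fintype.card ι) * 1 := by gcongr
      _ = ENNReal.ofReal (2 * Fintype.card ι) := by
        rw [two_mul, ENNReal.ofReal_add hM.le hM.le]
        simp
  have hle := hsum.trans hright
  -- Individual summands may be negative, so `ENNReal.ofReal` is only subadditive here, in the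
  -- direction needed.
  have hleft : ENNReal.ofReal (∑ w, (Real.log (Fintype.card ι) * (coupledLaw n Q1 Q2 N v).real
        {ω | (ω.1.1, ω.2.2, reducedOutput α (x1 w) (x2 w) ω) ∈ A w} -
      ∫ ω, logRatio α Q2 N T σ (x1 w) (x2 w) ω ∂coupledLaw n Q1 Q2 N v + 1)) ≤
      ENNReal.ofReal (2 * Fintype.card ι) :=
    le_trans (Finset.le_sum_of_subadditive _ ENNReal.ofReal_zero.le
      (fun _ _ => ENNReal.ofReal_add_le) _ _) hle
  rw [ENNReal.ofReal_le_ofReal_iff (by positivity), Finset.sum_add_distrib,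
    Finset.sum_sub_distrib, ← Finset.mul_sum] at hleft
  simp only [Finset.sum_const, Finset.card_univ, nsmul_eq_mul, mul_one] at hleft
  linarith

/-! ### The mean log-likelihood ratio -/

lemma integral_comp_of_measurePreserving {Ω Ω' : Type*} [MeasurableSpace Ω] [MeasurableSpace Ω']
    {μ : Measure Ω} {ν : Measure Ω'} {f : Ω → Ω'} (hf : MeasurePreserving f μ ν) {g : Ω' → ℝ}
    (hg : AEStronglyMeasurable g ν) : ∫ ω, g (f ω) ∂μ = ∫ x, g x ∂ν := by
  rw [← hf.map_eq, integral_map hf.aemeasurable (by rwa [hf.map_eq])]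

lemma integrable_logDensity_comp {Ω : Type*} [MeasurableSpace Ω] {μ : Measure Ω}
    [IsProbabilityMeasure μ] (v : ℝ) {f : Ω → Fin n → ℝ} (hf : ∀ i, MemLp (fun ω => f ω i) 2 μ) :
    Integrable (fun ω => logDensity v (f ω)) μ :=
  (integrable_const _).sub ((integrable_finsetSum _ fun i _ => (hf i).integrable_sq).div_const _)

lemma integral_logDensity_comp {Ω : Type*} [MeasurableSpace Ω] {μ : Measure Ω}
    [IsProbabilityMeasure μ] (v : ℝ) {f : Ω → Fin n → ℝ} (hf : ∀ i, MemLp (fun ω => f ω i) 2 μ) :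
    ∫ ω, logDensity v (f ω) ∂μ =
      -((n : ℝ) / 2 * Real.log (2 * Real.pi * v)) - (∑ i, ∫ ω, f ω i ^ 2 ∂μ) / (2 * v) := by
  unfold logDensity
  rw [integral_sub (integrable_const _)
    ((integrable_finsetSum _ fun i _ => (hf i).integrable_sq).div_const _), integral_div,
    integral_finsetSum _ fun i _ => (hf i).integrable_sq]
  simp

/-- Young's inequality isolates the state term `c` with a factor close to 1. The input `b` may be
correlated with `c`, so the cross term cannot be dropped. -/
lemma sq_add_le_weighted {a b c d δ : ℝ} (hδ : 0 < δ) :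
    (a + (b + c) + d) ^ 2 ≤ (1 + δ) * c ^ 2 + 3 * (1 + 1 / δ) * (a ^ 2 + b ^ 2 + d ^ 2) := by
  have h1 : (a + (b + c) + d) ^ 2 ≤ (1 + δ) * c ^ 2 + (1 + 1 / δ) * (a + b + d) ^ 2 := by
    have : (1 + δ) * c ^ 2 + (1 + 1 / δ) * (a + b + d) ^ 2 - (a + (b + c) + d) ^ 2 =
        (δ * c - (a + b + d)) ^ 2 / δ := by
      field_simp
      ring
    have h0 : 0 ≤ (δ * c - (a + b + d)) ^ 2 / δ := by positivity
    linarith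
  have h2 : (a + b + d) ^ 2 ≤ 3 * (a ^ 2 + b ^ 2 + d ^ 2) := by
    nlinarith [sq_nonneg (a - b), sq_nonneg (a - d), sq_nonneg (b - d)]
  have h3 : 0 ≤ 1 + 1 / δ := by positivity
  nlinarith [mul_le_mul_of_nonneg_left h2 h3]

section Coupled

variable {α Q1 Q2 N v : ℝ}

lemma measurePreserving_coupledLaw_state1 :
    MeasurePreserving (fun ω => ω.1.1) (coupledLaw n Q1 Q2 N v) (iidGaussian n Q1) :=
  measurePreserving_fst.comp measurePreserving_fst

lemma measurePreserving_coupledLaw_state2 :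
    MeasurePreserving (fun ω => ω.1.2) (coupledLaw n Q1 Q2 N v) (iidGaussian n Q2) :=
  measurePreserving_snd.comp measurePreserving_fst

lemma measurePreserving_coupledLaw_noise :
    MeasurePreserving (fun ω => ω.2.1) (coupledLaw n Q1 Q2 N v) (iidGaussian n N) :=
  measurePreserving_fst.comp measurePreserving_snd

lemma measurePreserving_coupledLaw_state2_noise :
    MeasurePreserving (fun ω => (ω.1.2, ω.2.1)) (coupledLaw n Q1 Q2 N v)
      ((iidGaussian n Q2).prod (iidGaussian n N)) :=
  MeasurePreserving.prod measurePreserving_snd measurePreserving_fst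

lemma memLp_coupledLaw_state1 {p : ENNReal} {f : (Fin n → ℝ) → ℝ}
    (hf : MemLp f p (iidGaussian n Q1)) :
    MemLp (fun ω => f ω.1.1) p (coupledLaw n Q1 Q2 N v) :=
  hf.comp_measurePreserving measurePreserving_coupledLaw_state1

lemma memLp_coupledLaw_state2 {p : ENNReal} {f : (Fin n → ℝ) → ℝ}
    (hf : MemLp f p (iidGaussian n Q2)) :
    MemLp (fun ω => f ω.1.2) p (coupledLaw n Q1 Q2 N v) :=
  hf.comp_measurePreserving measurePreserving_coupledLaw_state2

lemma memLp_coupledLaw_noise {p : ENNReal} {f : (Fin n → ℝ) → ℝ}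
    (hf : MemLp f p (iidGaussian n N)) :
    MemLp (fun ω => f ω.2.1) p (coupledLaw n Q1 Q2 N v) :=
  hf.comp_measurePreserving measurePreserving_coupledLaw_noise

lemma integral_sq_coupledLaw_state1 {f : (Fin n → ℝ) → ℝ} (hf : MemLp f 2 (iidGaussian n Q1)) :
    ∫ ω, f ω.1.1 ^ 2 ∂coupledLaw n Q1 Q2 N v = ∫ s, f s ^ 2 ∂iidGaussian n Q1 :=
  integral_comp_of_measurePreserving measurePreserving_coupledLaw_state1
    (g := fun s => f s ^ 2) hf.integrable_sq.aestronglyMeasurable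

lemma integral_sq_coupledLaw_state2 {f : (Fin n → ℝ) → ℝ} (hf : MemLp f 2 (iidGaussian n Q2)) :
    ∫ ω, f ω.1.2 ^ 2 ∂coupledLaw n Q1 Q2 N v = ∫ s, f s ^ 2 ∂iidGaussian n Q2 :=
  integral_comp_of_measurePreserving measurePreserving_coupledLaw_state2
    (g := fun s => f s ^ 2) hf.integrable_sq.aestronglyMeasurable

lemma integral_sq_coupledLaw_eval_state2 (hQ2 : 0 ≤ Q2) (i : Fin n) :
    ∫ ω, ω.1.2 i ^ 2 ∂coupledLaw n Q1 Q2 N v = Q2 :=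
  (integral_sq_coupledLaw_state2 (memLp_eval_iidGaussian Q2 i)).trans
    (integral_sq_eval_iidGaussian hQ2 i)

lemma integral_sq_coupledLaw_eval_noise (hN : 0 ≤ N) (i : Fin n) :
    ∫ ω, ω.2.1 i ^ 2 ∂coupledLaw n Q1 Q2 N v = N :=
  (integral_comp_of_measurePreserving measurePreserving_coupledLaw_noise (g := fun z => z i ^ 2)
    (memLp_eval_iidGaussian N i).integrable_sq.aestronglyMeasurable).trans
    (integral_sq_eval_iidGaussian hN i)

/-- The cross term vanishes because the noise is centred and independent of `S₂`. -/
lemma integral_sq_input_add_noise (hN : 0 < N) {x2 : (Fin n → ℝ) → (Fin n → ℝ)} {i : Fin n}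
    (hx : MemLp (fun s => x2 s i) 2 (iidGaussian n Q2)) :
    ∫ ω, (x2 ω.1.2 i + α⁻¹ * ω.2.1 i) ^ 2 ∂coupledLaw n Q1 Q2 N v =
      ∫ s, x2 s i ^ 2 ∂iidGaussian n Q2 + N / α ^ 2 := by
  have hz : MemLp (fun z : Fin n → ℝ => z i) 2 (iidGaussian n N) := memLp_eval_iidGaussian N i
  have hX := memLp_coupledLaw_state2 (Q1 := Q1) (N := N) (v := v) hx
  have hZ := memLp_coupledLaw_noise (Q1 := Q1) (Q2 := Q2) (v := v) hz
  have hXZ : Integrable (fun ω => x2 ω.1.2 i * ω.2.1 i) (coupledLaw n Q1 Q2 N v) :=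
    hX.integrable_mul hZ
  have hcross : ∫ ω, x2 ω.1.2 i * ω.2.1 i ∂coupledLaw n Q1 Q2 N v = 0 := by
    have := integral_comp_of_measurePreserving
      (measurePreserving_coupledLaw_state2_noise (n := n) (Q1 := Q1) (Q2 := Q2) (N := N) (v := v))
      (g := fun p => x2 p.1 i * p.2 i)
      (hx.aestronglyMeasurable.comp_fst.mul hz.aestronglyMeasurable.comp_snd)
    rw [this, integral_prod_mul (fun s => x2 s i) (fun z : Fin n → ℝ => z i),
      integral_eval_iidGaussian, mul_zero]
  calc _ = ∫ ω, (x2 ω.1.2 i ^ 2 + (2 * α⁻¹) * (x2 ω.1.2 i * ω.2.1 i) + (α⁻¹) ^ 2 * ω.2.1 i ^ 2)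
        ∂coupledLaw n Q1 Q2 N v := by congr 1; ext ω; ring
    _ = ∫ ω, x2 ω.1.2 i ^ 2 ∂coupledLaw n Q1 Q2 N v +
        (2 * α⁻¹) * ∫ ω, x2 ω.1.2 i * ω.2.1 i ∂coupledLaw n Q1 Q2 N v +
        (α⁻¹) ^ 2 * ∫ ω, ω.2.1 i ^ 2 ∂coupledLaw n Q1 Q2 N v := by
      rw [← integral_const_mul, ← integral_const_mul,
        ← integral_add hX.integrable_sq (hXZ.const_mul _)]
      exact integral_add (hX.integrable_sq.add (hXZ.const_mul _)) (hZ.integrable_sq.const_mul _)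
    _ = _ := by rw [hcross, integral_sq_coupledLaw_state2 hx, integral_sq_coupledLaw_eval_noise hN.le]; ring

variable {x1 x2 : (Fin n → ℝ) → (Fin n → ℝ)}

lemma memLp_reducedOutput (α : ℝ) (h1 : ∀ i, MemLp (fun s => x1 s i) 2 (iidGaussian n Q1))
    (h2 : ∀ i, MemLp (fun s => x2 s i) 2 (iidGaussian n Q2)) (i : Fin n) :
    MemLp (fun ω => reducedOutput α x1 x2 ω i) 2 (coupledLaw n Q1 Q2 N v) :=
  (((h1 i).comp_measurePreserving measurePreserving_coupledLaw_state1).add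
    ((((h2 i).comp_measurePreserving measurePreserving_coupledLaw_state2).add
      ((memLp_eval_iidGaussian Q2 i).comp_measurePreserving
        measurePreserving_coupledLaw_state2)).const_mul α)).add
    ((memLp_eval_iidGaussian N i).comp_measurePreserving measurePreserving_coupledLaw_noise)

lemma integral_sq_reducedOutput_le (hQ2 : 0 < Q2) (hN : 0 < N)
    (h1 : ∀ i, MemLp (fun s => x1 s i) 2 (iidGaussian n Q1))
    (h2 : ∀ i, MemLp (fun s => x2 s i) 2 (iidGaussian n Q2)) {δ : ℝ} (hδ : 0 < δ) (i : Fin n) :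
    ∫ ω, reducedOutput α x1 x2 ω i ^ 2 ∂coupledLaw n Q1 Q2 N v ≤
      (1 + δ) * (α ^ 2 * Q2) + 3 * (1 + 1 / δ) * (∫ s, x1 s i ^ 2 ∂iidGaussian n Q1 +
        α ^ 2 * ∫ s, x2 s i ^ 2 ∂iidGaussian n Q2 + N) := by
  have hX1 := (memLp_coupledLaw_state1 (Q2 := Q2) (N := N) (v := v) (h1 i)).integrable_sq
  have hX2 := (memLp_coupledLaw_state2 (Q1 := Q1) (N := N) (v := v) (h2 i)).integrable_sq.const_mul
    (α ^ 2)
  have hS := (memLp_coupledLaw_state2 (Q1 := Q1) (N := N) (v := v)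
    (memLp_eval_iidGaussian Q2 i)).integrable_sq.const_mul (α ^ 2)
  have hZ := (memLp_coupledLaw_noise (Q1 := Q1) (Q2 := Q2) (v := v)
    (memLp_eval_iidGaussian N i)).integrable_sq
  calc _ ≤ ∫ ω, ((1 + δ) * (α ^ 2 * ω.1.2 i ^ 2) + 3 * (1 + 1 / δ) *
        (x1 ω.1.1 i ^ 2 + α ^ 2 * x2 ω.1.2 i ^ 2 + ω.2.1 i ^ 2)) ∂coupledLaw n Q1 Q2 N v := by
        refine integral_mono (memLp_reducedOutput α h1 h2 i).integrable_sq
          ((hS.const_mul _).add (((hX1.add hX2).add hZ).const_mul _)) fun ω => ?_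
        have := sq_add_le_weighted (a := x1 ω.1.1 i) (b := α * x2 ω.1.2 i) (c := α * ω.1.2 i)
          (d := ω.2.1 i) hδ
        simp only [reducedOutput, Pi.add_apply, Pi.smul_apply, smul_eq_mul, mul_add]
        simp only [mul_pow] at this
        linarith
    _ = (1 + δ) * (α ^ 2 * ∫ ω, ω.1.2 i ^ 2 ∂coupledLaw n Q1 Q2 N v) + 3 * (1 + 1 / δ) *
        (∫ ω, x1 ω.1.1 i ^ 2 ∂coupledLaw n Q1 Q2 N v +
          α ^ 2 * ∫ ω, x2 ω.1.2 i ^ 2 ∂coupledLaw n Q1 Q2 N v +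
          ∫ ω, ω.2.1 i ^ 2 ∂coupledLaw n Q1 Q2 N v) := by
        rw [← integral_const_mul, ← integral_const_mul (α ^ 2), ← integral_const_mul,
          ← integral_add hX1 hX2]
        refine (integral_add (hS.const_mul _) (((hX1.add hX2).add hZ).const_mul _)).trans ?_
        congr 1
        rw [integral_const_mul]
        congr 1
        exact integral_add (hX1.add hX2) hZ
    _ = _ := by
        rw [integral_sq_coupledLaw_state1 (h1 i), integral_sq_coupledLaw_state2 (h2 i),
          integral_sq_coupledLaw_eval_state2 hQ2.le, integral_sq_coupledLaw_eval_noise hN.le]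

/-- The state cancels from its own estimation error, so the power of that error stays bounded as
`Q₂` grows. -/
lemma state2_sub_eq (hα : α ≠ 0)
    (ω : ((Fin n → ℝ) × (Fin n → ℝ)) × ((Fin n → ℝ) × (Fin n → ℝ))) (i : Fin n) :
    (ω.1.2 - α⁻¹ • (reducedOutput α x1 x2 ω - x1 ω.1.1)) i =
      -(x2 ω.1.2 i + α⁻¹ * ω.2.1 i) := by
  simp only [reducedOutput, Pi.add_apply, Pi.sub_apply, Pi.smul_apply, smul_eq_mul]
  field_simp
  ring

lemma memLp_state2_sub (hα : α ≠ 0)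
    (h2 : ∀ i, MemLp (fun s => x2 s i) 2 (iidGaussian n Q2)) (i : Fin n) :
    MemLp (fun ω => (ω.1.2 - α⁻¹ • (reducedOutput α x1 x2 ω - x1 ω.1.1)) i) 2
      (coupledLaw n Q1 Q2 N v) := by
  simp_rw [state2_sub_eq hα]
  exact (((h2 i).comp_measurePreserving measurePreserving_coupledLaw_state2).add
    (((memLp_eval_iidGaussian N i).comp_measurePreserving
      measurePreserving_coupledLaw_noise).const_mul _)).neg

lemma integrable_logRatio (hα : α ≠ 0) (T σ : ℝ)
    (h1 : ∀ i, MemLp (fun s => x1 s i) 2 (iidGaussian n Q1))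
    (h2 : ∀ i, MemLp (fun s => x2 s i) 2 (iidGaussian n Q2)) :
    Integrable (logRatio α Q2 N T σ x1 x2) (coupledLaw n Q1 Q2 N v) :=
  (((integrable_logDensity_comp _ fun i => (memLp_eval_iidGaussian Q2 i).comp_measurePreserving
    measurePreserving_coupledLaw_state2).add
    (integrable_logDensity_comp _ fun i => (memLp_eval_iidGaussian N i).comp_measurePreserving
      measurePreserving_coupledLaw_noise)).sub
    (integrable_logDensity_comp _ (memLp_reducedOutput α h1 h2))).sub
    (integrable_logDensity_comp _ (memLp_state2_sub hα h2))

/-- The two true densities contribute `-n / 2` each. The bound is affine in the input powers, with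
`T` and `σ` free, so it can be averaged over messages: the power constraint does not hold message by
message. -/
lemma integral_logRatio_le (hα : α ≠ 0) (hQ2 : 0 < Q2) (hN : 0 < N) {T σ δ : ℝ} (hT : 0 < T)
    (hσ : 0 < σ) (hδ : 0 < δ)
    (h1 : ∀ i, MemLp (fun s => x1 s i) 2 (iidGaussian n Q1))
    (h2 : ∀ i, MemLp (fun s => x2 s i) 2 (iidGaussian n Q2)) :
    ∫ ω, logRatio α Q2 N T σ x1 x2 ω ∂coupledLaw n Q1 Q2 N v ≤
      n / 2 * Real.log (T * σ / (Q2 * N)) - n +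
      ((1 + δ) * (α ^ 2 * (n * Q2)) + 3 * (1 + 1 / δ) *
        (∑ i, ∫ s, x1 s i ^ 2 ∂iidGaussian n Q1 +
          α ^ 2 * ∑ i, ∫ s, x2 s i ^ 2 ∂iidGaussian n Q2 + n * N)) / (2 * T) +
      (∑ i, ∫ s, x2 s i ^ 2 ∂iidGaussian n Q2 + n * (N / α ^ 2)) / (2 * σ) := by
  have mS (i : Fin n) := memLp_coupledLaw_state2 (Q1 := Q1) (N := N) (v := v)
    (memLp_eval_iidGaussian Q2 i)
  have mZ (i : Fin n) := memLp_coupledLaw_noise (Q1 := Q1) (Q2 := Q2) (v := v)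
    (memLp_eval_iidGaussian N i)
  have iS := integrable_logDensity_comp Q2 mS
  have iZ := integrable_logDensity_comp N mZ
  have iY := integrable_logDensity_comp T (memLp_reducedOutput (N := N) (v := v) α h1 h2)
  have iE := integrable_logDensity_comp σ
    (memLp_state2_sub (x1 := x1) (Q1 := Q1) (N := N) (v := v) hα h2)
  have hsplit : ∫ ω, logRatio α Q2 N T σ x1 x2 ω ∂coupledLaw n Q1 Q2 N v =
      ∫ ω, logDensity Q2 ω.1.2 ∂coupledLaw n Q1 Q2 N v +
      ∫ ω, logDensity N ω.2.1 ∂coupledLaw n Q1 Q2 N v -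
      ∫ ω, logDensity T (reducedOutput α x1 x2 ω) ∂coupledLaw n Q1 Q2 N v -
      ∫ ω, logDensity σ (ω.1.2 - α⁻¹ • (reducedOutput α x1 x2 ω - x1 ω.1.1))
        ∂coupledLaw n Q1 Q2 N v := by
    rw [← integral_add iS iZ]
    refine (integral_sub ((iS.add iZ).sub iY) iE).trans ?_
    congr 1
    exact integral_sub (iS.add iZ) iY
  have lS : ∫ ω, logDensity Q2 ω.1.2 ∂coupledLaw n Q1 Q2 N v =
      -((n : ℝ) / 2 * Real.log (2 * Real.pi * Q2)) - n / 2 := by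
    rw [integral_logDensity_comp Q2 mS]
    simp only [integral_sq_coupledLaw_eval_state2 hQ2.le, Finset.sum_const, Finset.card_univ,
      Fintype.card_fin, nsmul_eq_mul]
    field_simp
  have lZ : ∫ ω, logDensity N ω.2.1 ∂coupledLaw n Q1 Q2 N v =
      -((n : ℝ) / 2 * Real.log (2 * Real.pi * N)) - n / 2 := by
    rw [integral_logDensity_comp N mZ]
    simp only [integral_sq_coupledLaw_eval_noise hN.le, Finset.sum_const, Finset.card_univ,
      Fintype.card_fin, nsmul_eq_mul]
    field_simp
  have lY := integral_logDensity_comp T (memLp_reducedOutput (N := N) (v := v) α h1 h2)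
  have lE := integral_logDensity_comp σ
    (memLp_state2_sub (x1 := x1) (Q1 := Q1) (N := N) (v := v) hα h2)
  simp_rw [state2_sub_eq hα, neg_sq, integral_sq_input_add_noise hN (h2 _),
    Finset.sum_add_distrib] at lE
  have hY := Finset.sum_le_sum fun i (_ : i ∈ Finset.univ) =>
    integral_sq_reducedOutput_le (α := α) (v := v) hQ2 hN h1 h2 hδ i
  simp_rw [Finset.sum_add_distrib, ← Finset.mul_sum, Finset.sum_add_distrib] at hY
  simp only [← Finset.mul_sum, Finset.sum_const, Finset.card_univ, Fintype.card_fin,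
    nsmul_eq_mul] at hY lE
  have hY' := div_le_div_of_nonneg_right hY (by positivity : 0 ≤ 2 * T)
  have h2π : 2 * Real.pi ≠ 0 := by positivity
  have hlog : Real.log (T * σ / (Q2 * N)) = Real.log (2 * Real.pi * T) +
      Real.log (2 * Real.pi * σ) - Real.log (2 * Real.pi * Q2) - Real.log (2 * Real.pi * N) := by
    rw [Real.log_div (by positivity) (by positivity), Real.log_mul hT.ne' hσ.ne',
      Real.log_mul hQ2.ne' hN.ne', Real.log_mul h2π hT.ne', Real.log_mul h2π hσ.ne',
      Real.log_mul h2π hQ2.ne', Real.log_mul h2π hN.ne']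
    ring
  rw [hsplit, lS, lZ, lY, lE, hlog]
  linarith

end Coupled

/-! ### One receiver decodes both messages -/

variable {M M1 M2 : ℕ}

lemma PowerLimited.memLp {enc : Fin M → (Fin n → ℝ) → (Fin n → ℝ)} {Q P : ℝ}
    (h : PowerLimited enc Q P) (henc : ∀ w, Measurable (enc w)) (w : Fin M) (j : Fin n) :
    MemLp (fun s => enc w s j) 2 (iidGaussian n Q) := by
  have := henc w
  exact (memLp_two_iff_integrable_sq (by fun_prop)).2 (h.1 w j)

lemma PowerLimited.sum_le {enc : Fin M → (Fin n → ℝ) → (Fin n → ℝ)} {Q P : ℝ}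
    (h : PowerLimited enc Q P) (hn : 0 < n) (hM : 0 < M) :
    ∑ w, ∑ j, ∫ s, enc w s j ^ 2 ∂iidGaussian n Q ≤ M * (n * P) := by
  have h2 := h.2
  rw [← Finset.mul_sum, Finset.sum_comm] at h2
  have hn' : (0 : ℝ) < n := by exact_mod_cast hn
  have hM' : (0 : ℝ) < M := by exact_mod_cast hM
  rw [one_div, one_div, inv_mul_le_iff₀ hn', inv_mul_le_iff₀ hM'] at h2
  exact h2

instance instIsProbabilityMeasureLaw (c : ASDGIC) (n : ℕ) : IsProbabilityMeasure (c.law n) := by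
  unfold law; infer_instance

lemma mul_errorProb (c : ASDGIC) (C : Code n M1 M2) (h1 : 0 < M1) (h2 : 0 < M2) :
    (M1 : ℝ) * M2 * c.errorProb C =
      ∑ w : Fin M1 × Fin M2, (c.law n).real (c.errorEvent C w.1 w.2) := by
  have h1' : (M1 : ℝ) ≠ 0 := by exact_mod_cast h1.ne'
  have h2' : (M2 : ℝ) ≠ 0 := by exact_mod_cast h2.ne'
  rw [errorProb, Fintype.sum_prod_type]
  field_simp

/-- The triples `(s₁, v, y)` from which receiver 1, knowing `s₁`, the reduced output `y` and the
auxiliary noise `v`, recovers both messages. -/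
def jointDecodingRegion (c : ASDGIC) (C : Code n M1 M2) (w : Fin M1 × Fin M2) :
    Set ((Fin n → ℝ) × (Fin n → ℝ) × (Fin n → ℝ)) :=
  {p | C.dec1 (p.2.2 + p.1) = w.1 ∧
    C.dec2 (√c.a21 • (C.enc1 w.1 p.1 + p.1) +
      (√c.a12)⁻¹ • (p.2.2 - C.enc1 w.1 p.1) + p.2.1) = w.2}

lemma measurableSet_jointDecodingRegion (c : ASDGIC) (C : Code n M1 M2) (w : Fin M1 × Fin M2) :
    MeasurableSet (c.jointDecodingRegion C w) := by
  have h1 := C.measurable_enc1 w.1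
  refine MeasurableSet.inter
    (measurableSet_preimage (C.measurable_dec1.comp ?_) (measurableSet_singleton w.1))
    (measurableSet_preimage (C.measurable_dec2.comp ?_) (measurableSet_singleton w.2)) <;>
  fun_prop

lemma pairwise_disjoint_jointDecodingRegion (c : ASDGIC) (C : Code n M1 M2) :
    Pairwise (Function.onFun Disjoint (c.jointDecodingRegion C)) := by
  rintro ⟨w1, w2⟩ ⟨w1', w2'⟩ hne
  refine Set.disjoint_left.2 fun p hp hp' => hne ?_
  have h1 : w1 = w1' := hp.1.symm.trans hp'.1
  subst h1
  exact congrArg _ (hp.2.symm.trans hp'.2)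

/-- Replacing `Z₂` by `Z₁ / α + V` changes the joint law of the noises but preserves the law seen by
each receiver separately. Each decoder's error is thus bounded by the original error probability,
and the union bound costs the factor 2. -/
lemma one_sub_two_mul_measureReal_errorEvent_le (c : ASDGIC) (C : Code n M1 M2)
    (h12 : 0 < c.a12) (hN1 : 0 < c.N1) (hdeg : c.N1 / c.a12 ≤ c.N2) (w : Fin M1 × Fin M2) :
    1 - 2 * (c.law n).real (c.errorEvent C w.1 w.2) ≤
      (coupledLaw n c.Q1 c.Q2 c.N1 (c.N2 - c.N1 / c.a12)).real
        {ω | (ω.1.1, ω.2.2, reducedOutput (√c.a12) (C.enc1 w.1) (C.enc2 w.2) ω) ∈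
          c.jointDecodingRegion C w} := by
  have hα : √c.a12 ≠ 0 := (Real.sqrt_pos.2 h12).ne'
  have hsq : √c.a12 ^ 2 = c.a12 := Real.sq_sqrt h12.le
  have m1 := C.measurable_enc1 w.1
  have m2 := C.measurable_enc2 w.2
  have md1 := C.measurable_dec1
  have md2 := C.measurable_dec2
  set μ := coupledLaw n c.Q1 c.Q2 c.N1 (c.N2 - c.N1 / c.a12)
  set B := {ω | (ω.1.1, ω.2.2, reducedOutput (√c.a12) (C.enc1 w.1) (C.enc2 w.2) ω) ∈
          c.jointDecodingRegion C w}
  let E1 : Set (((Fin n → ℝ) × (Fin n → ℝ)) × (Fin n → ℝ)) :=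
    {p | C.dec1 (c.output1 (C.enc1 w.1 p.1.1) (C.enc2 w.2 p.1.2) p.1.1 p.1.2 p.2) ≠ w.1}
  let E2 : Set (((Fin n → ℝ) × (Fin n → ℝ)) × (Fin n → ℝ)) :=
    {p | C.dec2 (c.output2 (C.enc1 w.1 p.1.1) (C.enc2 w.2 p.1.2) p.1.1 p.1.2 p.2) ≠ w.2}
  have hE1 : MeasurableSet E1 :=
    (measurableSet_preimage (f := fun p : ((Fin n → ℝ) × (Fin n → ℝ)) × (Fin n → ℝ) =>
      C.dec1 (c.output1 (C.enc1 w.1 p.1.1) (C.enc2 w.2 p.1.2) p.1.1 p.1.2 p.2))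
      (by unfold output1; fun_prop) (measurableSet_singleton w.1)).compl
  have hE2 : MeasurableSet E2 :=
    (measurableSet_preimage (f := fun p : ((Fin n → ℝ) × (Fin n → ℝ)) × (Fin n → ℝ) =>
      C.dec2 (c.output2 (C.enc1 w.1 p.1.1) (C.enc2 w.2 p.1.2) p.1.1 p.1.2 p.2))
      (by unfold output2; fun_prop) (measurableSet_singleton w.2)).compl
  have p1 : MeasurePreserving (fun ω => (ω.1, ω.2.1)) μ
      (((iidGaussian n c.Q1).prod (iidGaussian n c.Q2)).prod (iidGaussian n c.N1)) :=
    (MeasurePreserving.id _).prod measurePreserving_fst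
  have p2 : MeasurePreserving (fun ω => (ω.1, (√c.a12)⁻¹ • ω.2.1 + ω.2.2)) μ
      (((iidGaussian n c.Q1).prod (iidGaussian n c.Q2)).prod (iidGaussian n c.N2)) := by
    have := measurePreserving_smul_add_iidGaussian n (α := √c.a12) (N' := c.N2) hN1.le (by rwa [hsq])
    rw [hsq] at this
    exact (MeasurePreserving.id _).prod this
  have q1 : MeasurePreserving (fun ω => (ω.1, ω.2.1)) (c.law n)
      (((iidGaussian n c.Q1).prod (iidGaussian n c.Q2)).prod (iidGaussian n c.N1)) :=
    (MeasurePreserving.id _).prod measurePreserving_fst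
  have q2 : MeasurePreserving (fun ω => (ω.1, ω.2.2)) (c.law n)
      (((iidGaussian n c.Q1).prod (iidGaussian n c.Q2)).prod (iidGaussian n c.N2)) :=
    (MeasurePreserving.id _).prod measurePreserving_snd
  have hsub : Bᶜ ⊆ (fun ω => (ω.1, ω.2.1)) ⁻¹' E1 ∪
      (fun ω => (ω.1, (√c.a12)⁻¹ • ω.2.1 + ω.2.2)) ⁻¹' E2 := by
    intro ω hω
    by_contra hcon
    simp only [Set.mem_union, Set.mem_preimage, not_or, E1, E2, Set.mem_ofPred_eq, not_not] at hcon
    refine hω ⟨?_, ?_⟩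
    · refine (congrArg C.dec1 ?_).trans hcon.1
      simp only [reducedOutput, output1, smul_add]
      abel
    · refine (congrArg C.dec2 ?_).trans hcon.2
      simp only [reducedOutput, output2, smul_add, smul_sub, inv_smul_smul₀ hα]
      abel
  have hB : MeasurableSet B :=
    measurableSet_preimage (by fun_prop) (c.measurableSet_jointDecodingRegion C w)
  have hle1 : μ.real ((fun ω => (ω.1, ω.2.1)) ⁻¹' E1) ≤ (c.law n).real (c.errorEvent C w.1 w.2) := by
    rw [p1.measureReal_preimage hE1.nullMeasurableSet,
      ← q1.measureReal_preimage hE1.nullMeasurableSet]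
    exact measureReal_mono fun ω hω => Or.inl hω
  have hle2 : μ.real ((fun ω => (ω.1, (√c.a12)⁻¹ • ω.2.1 + ω.2.2)) ⁻¹' E2) ≤
      (c.law n).real (c.errorEvent C w.1 w.2) := by
    rw [p2.measureReal_preimage hE2.nullMeasurableSet,
      ← q2.measureReal_preimage hE2.nullMeasurableSet]
    exact measureReal_mono fun ω hω => Or.inr hω
  have hcompl := (measureReal_mono (μ := μ) hsub).trans (measureReal_union_le _ _)
  rw [probReal_compl_eq_one_sub hB] at hcompl
  linarith

/-- Finite-length converse on the sum rate. -/
lemma one_sub_errorProb_mul_log_le (c : ASDGIC) (C : Code n M1 M2) (hn : 0 < n) (hM1 : 0 < M1)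
    (hM2 : 0 < M2) (h12 : 0 < c.a12) (hP1 : 0 < c.P1) (hP2 : 0 < c.P2) (hN1 : 0 < c.N1)
    (hQ2 : 0 < c.Q2) (hdeg : c.N1 / c.a12 ≤ c.N2) (hp1 : PowerLimited C.enc1 c.Q1 c.P1)
    (hp2 : PowerLimited C.enc2 c.Q2 c.P2) {δ : ℝ} (hδ : 0 < δ) :
    (1 - 2 * c.errorProb C) * Real.log (M1 * M2) ≤
      n / 2 * Real.log (((1 + δ) * (c.a12 * c.Q2) +
        3 * (1 + 1 / δ) * (c.P1 + c.a12 * c.P2 + c.N1)) * (c.P2 + c.N1 / c.a12) /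
          (c.Q2 * c.N1)) + 1 := by
  have hα : √c.a12 ≠ 0 := (Real.sqrt_pos.2 h12).ne'
  have hsq : √c.a12 ^ 2 = c.a12 := Real.sq_sqrt h12.le
  have : Nonempty (Fin M1 × Fin M2) := ⟨(⟨0, hM1⟩, ⟨0, hM2⟩)⟩
  -- `T` and `σ` equal the message-averaged power bounds per letter, so each quadratic term below is
  -- at most `n / 2` on average and together they cancel the `-n`.
  set T := (1 + δ) * (c.a12 * c.Q2) + 3 * (1 + 1 / δ) * (c.P1 + c.a12 * c.P2 + c.N1) with hTdef
  set σ := c.P2 + c.N1 / c.a12 with hσdef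
  have hT : 0 < T := by positivity
  have hσ : 0 < σ := by positivity
  have hM1' : (0 : ℝ) < M1 := by exact_mod_cast hM1
  have hM2' : (0 : ℝ) < M2 := by exact_mod_cast hM2
  have hn' : (0 : ℝ) < n := by exact_mod_cast hn
  have ml1 := hp1.memLp C.measurable_enc1
  have ml2 := hp2.memLp C.measurable_enc2
  have hmain := sum_log_mul_measureReal_le (ι := Fin M1 × Fin M2) (α := √c.a12) (Q1 := c.Q1)
    (v := c.N2 - c.N1 / c.a12) hQ2 hN1 hT hσ
    (x1 := fun w => C.enc1 w.1) (x2 := fun w => C.enc2 w.2) (fun w => C.measurable_enc1 w.1)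
    (fun w => C.measurable_enc2 w.2)
    (fun w => integrable_logRatio hα T σ (ml1 w.1) (ml2 w.2))
    (c.measurableSet_jointDecodingRegion C) (c.pairwise_disjoint_jointDecodingRegion C)
  have hcard : ((Fintype.card (Fin M1 × Fin M2) : ℕ) : ℝ) = M1 * M2 := by simp
  rw [hcard] at hmain
  have hlog : 0 ≤ Real.log ((M1 : ℝ) * M2) := by
    refine Real.log_nonneg ?_
    exact_mod_cast Nat.mul_pos hM1 hM2
  have hprob := Finset.sum_le_sum fun w (_ : w ∈ Finset.univ) =>
    c.one_sub_two_mul_measureReal_errorEvent_le C h12 hN1 hdeg w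
  rw [Finset.sum_sub_distrib, ← Finset.mul_sum, ← c.mul_errorProb C hM1 hM2] at hprob
  simp only [Finset.sum_const, Finset.card_univ, nsmul_eq_mul, mul_one, hcard] at hprob
  have hdiv := Finset.sum_le_sum fun w (_ : w ∈ (Finset.univ : Finset (Fin M1 × Fin M2))) =>
    integral_logRatio_le (v := c.N2 - c.N1 / c.a12) hα hQ2 hN1 hT hσ hδ (ml1 w.1) (ml2 w.2)
  set p1 : Fin M1 → ℝ := fun w => ∑ i, ∫ s, C.enc1 w s i ^ 2 ∂iidGaussian n c.Q1
  set p2 : Fin M2 → ℝ := fun w => ∑ i, ∫ s, C.enc2 w s i ^ 2 ∂iidGaussian n c.Q2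
  have hs1 : ∑ w : Fin M1 × Fin M2, p1 w.1 ≤ M1 * M2 * (n * c.P1) := by
    rw [Fintype.sum_prod_type]
    simp only [Finset.sum_const, Finset.card_univ, Fintype.card_fin, nsmul_eq_mul]
    rw [← Finset.mul_sum]
    calc _ ≤ (M2 : ℝ) * (M1 * (n * c.P1)) := by gcongr; exact hp1.sum_le hn hM1
      _ = _ := by ring
  have hs2 : ∑ w : Fin M1 × Fin M2, p2 w.2 ≤ M1 * M2 * (n * c.P2) := by
    rw [Fintype.sum_prod_type_right]
    simp only [Finset.sum_const, Finset.card_univ, Fintype.card_fin, nsmul_eq_mul]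
    rw [← Finset.mul_sum]
    calc _ ≤ (M1 : ℝ) * (M2 * (n * c.P2)) := by gcongr; exact hp2.sum_le hn hM2
      _ = _ := by ring
  rw [hsq] at hdiv
  have hdiv' : ∑ w : Fin M1 × Fin M2, ∫ ω, logRatio (√c.a12) c.Q2 c.N1 T σ (C.enc1 w.1)
      (C.enc2 w.2) ω ∂coupledLaw n c.Q1 c.Q2 c.N1 (c.N2 - c.N1 / c.a12) ≤
      M1 * M2 * (n / 2 * Real.log (T * σ / (c.Q2 * c.N1))) := by
    refine hdiv.trans ?_
    have hexpand : ∑ w : Fin M1 × Fin M2, (n / 2 * Real.log (T * σ / (c.Q2 * c.N1)) - n +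
        ((1 + δ) * (c.a12 * (n * c.Q2)) + 3 * (1 + 1 / δ) *
          (p1 w.1 + c.a12 * p2 w.2 + n * c.N1)) / (2 * T) +
        (p2 w.2 + n * (c.N1 / c.a12)) / (2 * σ)) =
        M1 * M2 * (n / 2 * Real.log (T * σ / (c.Q2 * c.N1)) - n) +
        (M1 * M2 * ((1 + δ) * (c.a12 * (n * c.Q2))) + 3 * (1 + 1 / δ) *
          (∑ w : Fin M1 × Fin M2, p1 w.1 + c.a12 * ∑ w : Fin M1 × Fin M2, p2 w.2 +
            M1 * M2 * (n * c.N1))) / (2 * T) +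
        (∑ w : Fin M1 × Fin M2, p2 w.2 + M1 * M2 * (n * (c.N1 / c.a12))) / (2 * σ) := by
      simp only [Finset.sum_add_distrib, ← Finset.sum_div, ← Finset.mul_sum, Finset.sum_const,
        Finset.card_univ, nsmul_eq_mul, hcard]
      ring
    refine hexpand.le.trans ?_
    have b1 : (M1 * M2 * ((1 + δ) * (c.a12 * (n * c.Q2))) + 3 * (1 + 1 / δ) *
          (∑ w : Fin M1 × Fin M2, p1 w.1 + c.a12 * ∑ w : Fin M1 × Fin M2, p2 w.2 +
            M1 * M2 * (n * c.N1))) / (2 * T) ≤ M1 * M2 * (n / 2) := by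
      rw [div_le_iff₀ (by positivity)]
      calc _ ≤ M1 * M2 * ((1 + δ) * (c.a12 * (n * c.Q2))) + 3 * (1 + 1 / δ) *
            (M1 * M2 * (n * c.P1) + c.a12 * (M1 * M2 * (n * c.P2)) + M1 * M2 * (n * c.N1)) := by
              gcongr
        _ = _ := by rw [hTdef]; ring
    have b2 : (∑ w : Fin M1 × Fin M2, p2 w.2 + M1 * M2 * (n * (c.N1 / c.a12))) / (2 * σ) ≤
        M1 * M2 * (n / 2) := by
      rw [div_le_iff₀ (by positivity)]
      calc _ ≤ M1 * M2 * (n * c.P2) + M1 * M2 * (n * (c.N1 / c.a12)) := by gcongr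
        _ = _ := by rw [hσdef]; ring
    linarith
  have hchain := (mul_le_mul_of_nonneg_left hprob hlog).trans (hmain.trans
    (add_le_add_left hdiv' _))
  have hMM : (0 : ℝ) < M1 * M2 := by positivity
  refine le_of_mul_le_mul_left ?_ hMM
  calc _ = Real.log (M1 * M2) * (M1 * M2 - 2 * (M1 * M2 * c.errorProb C)) := by ring
    _ ≤ _ := hchain
    _ = _ := by ring

/-! ### Long blocks and strong states -/

lemma numMessages_pos (n : ℕ) (R : ℝ) : 0 < numMessages n R :=
  Nat.ceil_pos.2 (by positivity)

lemma mul_log_two_le_log_numMessages (n : ℕ) (R : ℝ) :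
    n * R * Real.log 2 ≤ Real.log (numMessages n R) := by
  rw [← Real.log_rpow two_pos]
  exact Real.log_le_log (by positivity) (Nat.le_ceil _)

/-- Asymptotic converse on the sum rate at fixed state variances. -/
lemma Achievable.add_mul_log_two_le {c : ASDGIC} {R : ℝ × ℝ} (hR : c.Achievable R)
    (h12 : 0 < c.a12) (hP1 : 0 < c.P1) (hP2 : 0 < c.P2) (hN1 : 0 < c.N1) (hQ2 : 0 < c.Q2)
    (hdeg : c.N1 / c.a12 ≤ c.N2) {δ : ℝ} (hδ : 0 < δ) :
    (R.1 + R.2) * Real.log 2 ≤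
      1 / 2 * Real.log (((1 + δ) * (c.a12 * c.Q2) +
        3 * (1 + 1 / δ) * (c.P1 + c.a12 * c.P2 + c.N1)) * (c.P2 + c.N1 / c.a12) /
          (c.Q2 * c.N1)) := by
  obtain ⟨-, -, C, hpow, herr⟩ := hR
  set L := Real.log (((1 + δ) * (c.a12 * c.Q2) +
        3 * (1 + 1 / δ) * (c.P1 + c.a12 * c.P2 + c.N1)) * (c.P2 + c.N1 / c.a12) /
          (c.Q2 * c.N1))
  have hl : Tendsto (fun n => (1 - 2 * c.errorProb (C n)) * ((R.1 + R.2) * Real.log 2)) atTop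
      (𝓝 ((1 - 2 * 0) * ((R.1 + R.2) * Real.log 2))) :=
    ((herr.const_mul 2).const_sub 1).mul_const _
  have hr : Tendsto (fun n : ℕ => 1 / 2 * L + 1 / (n : ℝ)) atTop (𝓝 (1 / 2 * L + 0)) :=
    tendsto_one_div_atTop_nhds_zero_nat.const_add _
  have hle := le_of_tendsto_of_tendsto hl hr ?_
  · simpa using hle
  -- This makes the factor `1 - 2 * errorProb` nonnegative, so the rate bound may be multiplied by
  -- it.
  have hsmall : ∀ᶠ n in atTop, c.errorProb (C n) < 1 / 2 :=
    herr.eventually (gt_mem_nhds (by norm_num))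
  filter_upwards [hsmall, eventually_gt_atTop 0] with n hn hpos
  have hn' : (0 : ℝ) < n := by exact_mod_cast hpos
  have hmain := c.one_sub_errorProb_mul_log_le (C n) hpos (numMessages_pos n R.1)
    (numMessages_pos n R.2) h12 hP1 hP2 hN1 hQ2 hdeg (hpow n).1 (hpow n).2 hδ
  have h1 : (0 : ℝ) < numMessages n R.1 := by exact_mod_cast numMessages_pos n R.1
  have h2 : (0 : ℝ) < numMessages n R.2 := by exact_mod_cast numMessages_pos n R.2
  rw [Real.log_mul h1.ne' h2.ne'] at hmain
  have hrate : n * ((R.1 + R.2) * Real.log 2) ≤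
      Real.log (numMessages n R.1) + Real.log (numMessages n R.2) := by
    linarith [mul_log_two_le_log_numMessages n R.1, mul_log_two_le_log_numMessages n R.2]
  have hchain := (mul_le_mul_of_nonneg_left hrate (by linarith : 0 ≤ 1 - 2 * c.errorProb (C n))).trans
    hmain
  refine le_of_mul_le_mul_left ?_ hn'
  calc _ = (1 - 2 * c.errorProb (C n)) * (n * ((R.1 + R.2) * Real.log 2)) := by ring
    _ ≤ _ := hchain
    _ = n / 2 * L + n * (1 / n) := by rw [mul_one_div_cancel hn'.ne']
    _ = _ := by ring

/-- As the second state gets strong, the sum rate is limited by the second user's power. -/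
lemma exists_forall_achievable_add_le {a12 a21 P1 P2 N1 N2 : ℝ} (hP1 : 0 < P1) (hP2 : 0 < P2)
    (hN1 : 0 < N1) (hN2 : 0 < N2) (ha12 : N1 / N2 ≤ a12) {ε : ℝ} (hε : 0 < ε) :
    ∃ Q0 : ℝ, ∀ Q1 Q2 : ℝ, Q0 ≤ Q2 → ∀ R,
      Achievable ⟨a12, a21, P1, P2, N1, N2, Q1, Q2⟩ R →
        R.1 + R.2 ≤ 1 / 2 * Real.logb 2 (1 + a12 * P2 / N1) + ε := by
  have h12 : 0 < a12 := (div_pos hN1 hN2).trans_le ha12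
  have hdeg : N1 / a12 ≤ N2 := by
    rw [div_le_iff₀ h12]
    rwa [div_le_iff₀' hN2] at ha12
  have hlog2 : 0 < Real.log 2 := Real.log_pos one_lt_two
  -- The Young parameter and the remainder `K / (a12 * Q2)` each cost at most `δ` inside `½ log (1 +
  -- ·)`, a total of `δ = ε log 2`, that is, `ε` bits. The threshold `K / (a12 * δ)` makes the
  -- remainder at most `δ`.
  set δ := ε * Real.log 2 with hδdef
  have hδ : 0 < δ := mul_pos hε hlog2
  set K := 3 * (1 + 1 / δ) * (P1 + a12 * P2 + N1) with hKdef
  have hK : 0 < K := by positivity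
  refine ⟨K / (a12 * δ), fun Q1 Q2 hQ R hR => ?_⟩
  have hQ2 : 0 < Q2 := (by positivity : 0 < K / (a12 * δ)).trans_le hQ
  have hbound := hR.add_mul_log_two_le h12 hP1 hP2 hN1 hQ2 hdeg hδ
  simp only [← hKdef] at hbound
  have hsplit : ((1 + δ) * (a12 * Q2) + K) * (P2 + N1 / a12) / (Q2 * N1) =
      (1 + (δ + K / (a12 * Q2))) * (1 + a12 * P2 / N1) := by
    field_simp
    ring
  have hfrac : K / (a12 * Q2) ≤ δ := by
    rw [div_le_iff₀ (by positivity)] at hQ ⊢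
    linarith
  have hpos : 0 < K / (a12 * Q2) := by positivity
  rw [hsplit, Real.log_mul (by positivity) (by positivity)] at hbound
  have hlog := Real.log_le_sub_one_of_pos (x := 1 + (δ + K / (a12 * Q2))) (by positivity)
  refine le_of_mul_le_mul_right ?_ hlog2
  rw [Real.logb, add_mul (_ * _), mul_assoc, div_mul_cancel₀ _ hlog2.ne']
  linarith

/-! ### Exchange of the users and the limit region -/

/-- The channel with the two users exchanged. -/
def swap (c : ASDGIC) : ASDGIC := ⟨c.a21, c.a12, c.P2, c.P1, c.N2, c.N1, c.Q2, c.Q1⟩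

/-- The code with the two users exchanged. -/
def Code.swap (C : Code n M1 M2) : Code n M2 M1 where
  enc1 := C.enc2
  enc2 := C.enc1
  dec1 := C.dec2
  dec2 := C.dec1
  measurable_enc1 := C.measurable_enc2
  measurable_enc2 := C.measurable_enc1
  measurable_dec1 := C.measurable_dec2
  measurable_dec2 := C.measurable_dec1

lemma measurableSet_errorEvent (c : ASDGIC) (C : Code n M1 M2) (w1 : Fin M1) (w2 : Fin M2) :
    MeasurableSet (c.errorEvent C w1 w2) := by
  have := C.measurable_enc1 w1
  have := C.measurable_enc2 w2
  refine MeasurableSet.union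
    (measurableSet_preimage (C.measurable_dec1.comp ?_) (measurableSet_singleton w1)).compl
    (measurableSet_preimage (C.measurable_dec2.comp ?_) (measurableSet_singleton w2)).compl
  · unfold output1; fun_prop
  · unfold output2; fun_prop

lemma errorProb_swap (c : ASDGIC) (C : Code n M1 M2) : c.swap.errorProb C.swap = c.errorProb C := by
  rw [errorProb, errorProb, Finset.sum_comm, mul_comm (M1 : ℝ)]
  congr 1
  refine Finset.sum_congr rfl fun w1 _ => Finset.sum_congr rfl fun w2 _ => ?_
  have hmp : MeasurePreserving (Prod.map Prod.swap Prod.swap) (c.law n) (c.swap.law n) :=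
    Measure.measurePreserving_swap.prod Measure.measurePreserving_swap
  rw [← hmp.measureReal_preimage (c.swap.measurableSet_errorEvent _ _ _).nullMeasurableSet]
  congr 1
  ext ω
  have e1 : c.swap.output1 (C.enc2 w2 ω.1.2) (C.enc1 w1 ω.1.1) ω.1.2 ω.1.1 ω.2.2 =
      c.output2 (C.enc1 w1 ω.1.1) (C.enc2 w2 ω.1.2) ω.1.1 ω.1.2 ω.2.2 := by
    simp only [output1, output2, swap]
    abel
  have e2 : c.swap.output2 (C.enc2 w2 ω.1.2) (C.enc1 w1 ω.1.1) ω.1.2 ω.1.1 ω.2.1 =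
      c.output1 (C.enc1 w1 ω.1.1) (C.enc2 w2 ω.1.2) ω.1.1 ω.1.2 ω.2.1 := by
    simp only [output1, output2, swap]
    abel
  rw [Set.mem_preimage, errorEvent, errorEvent, Set.mem_ofPred_eq, Set.mem_ofPred_eq, ← e1, ← e2]
  exact or_comm

lemma Achievable.swap {c : ASDGIC} {R : ℝ × ℝ} (h : c.Achievable R) :
    c.swap.Achievable R.swap := by
  obtain ⟨h1, h2, C, hpow, herr⟩ := h
  refine ⟨h2, h1, fun n => (C n).swap, fun n => (hpow n).symm, ?_⟩
  have : (fun n => c.swap.errorProb (C n).swap) = fun n => c.errorProb (C n) :=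
    funext fun n => c.errorProb_swap (C n)
  exact this ▸ herr

lemma isClosed_sumRateRegion (B : ℝ) : IsClosed (sumRateRegion B) :=
  (isClosed_le continuous_const continuous_fst).inter
    ((isClosed_le continuous_const continuous_snd).inter
      (isClosed_le (continuous_fst.add continuous_snd) continuous_const))

/-- Uniform bound on the capacity region for strong states. -/
lemma exists_forall_capacityRegion_subset {a12 a21 P1 P2 N1 N2 : ℝ} (hP1 : 0 < P1) (hP2 : 0 < P2)
    (hN1 : 0 < N1) (hN2 : 0 < N2) (ha12 : N1 / N2 ≤ a12) (ha21 : N2 / N1 ≤ a21) {ε : ℝ}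
    (hε : 0 < ε) :
    ∃ Q0 : ℝ, ∀ Q1 Q2 : ℝ, Q0 ≤ Q1 → Q0 ≤ Q2 →
      capacityRegion ⟨a12, a21, P1, P2, N1, N2, Q1, Q2⟩ ⊆
        sumRateRegion (sumRateBound a12 a21 P1 P2 N1 N2 + ε) := by
  obtain ⟨q, hq⟩ := exists_forall_achievable_add_le (a21 := a21) hP1 hP2 hN1 hN2 ha12 hε
  obtain ⟨q', hq'⟩ := exists_forall_achievable_add_le (a21 := a12) hP2 hP1 hN2 hN1 ha21 hε
  refine ⟨max q q', fun Q1 Q2 hQ1 hQ2 =>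
    closure_minimal (fun R hR => ⟨hR.1, hR.2.1, ?_⟩) (isClosed_sumRateRegion _)⟩
  rw [sumRateBound, ← sub_le_iff_le_add]
  refine le_min (sub_le_iff_le_add.2 <| hq Q1 Q2 ((le_max_left _ _).trans hQ2) R hR) ?_
  rw [sub_le_iff_le_add]
  have := hq' Q2 Q1 ((le_max_right _ _).trans hQ1) R.swap hR.swap
  rwa [Prod.fst_swap, Prod.snd_swap, add_comm] at this

end ASDGIC

end

theorem theorem1 (a12 a21 P1 P2 N1 N2 : ℝ)
    (hP1 : 0 < P1) (hP2 : 0 < P2) (hN1 : 0 < N1) (hN2 : 0 < N2)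
    (ha12 : N1 / N2 ≤ a12) (ha21 : N2 / N1 ≤ a21) :
    ASDGIC.limitCapacityRegion a12 a21 P1 P2 N1 N2 ⊆
        ASDGIC.sumRateRegion (ASDGIC.sumRateBound a12 a21 P1 P2 N1 N2) ∧
      ∀ ε : ℝ, 0 < ε → ∃ Q0 : ℝ, ∀ Q1 Q2 : ℝ, Q0 ≤ Q1 → Q0 ≤ Q2 →
        ASDGIC.capacityRegion ⟨a12, a21, P1, P2, N1, N2, Q1, Q2⟩ ⊆
          ASDGIC.sumRateRegion (ASDGIC.sumRateBound a12 a21 P1 P2 N1 N2 + ε) := by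
  have huniform (ε : ℝ) (hε : 0 < ε) := ASDGIC.exists_forall_capacityRegion_subset hP1 hP2 hN1 hN2
    ha12 ha21 hε
  refine ⟨fun R hR => ?_, huniform⟩
  have hmem (ε : ℝ) (hε : 0 < ε) :
      R ∈ ASDGIC.sumRateRegion (ASDGIC.sumRateBound a12 a21 P1 P2 N1 N2 + ε) := by
    obtain ⟨Q0, hQ0⟩ := huniform ε hε
    -- Every neighbourhood of `R` meets capacity regions for frequently many `Q`, hence for some `Q`
    -- beyond the uniform threshold; closedness then puts `R` in the enlarged region.
    rw [← (ASDGIC.isClosed_sumRateRegion _).closure_eq, mem_closure_iff_nhds]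
    intro U hU
    obtain ⟨Q, ⟨R', hR', hR'U⟩, hQ1, hQ2⟩ := ((hR U hU).and_eventually
      ((eventually_ge_atTop Q0).prod_mk (eventually_ge_atTop Q0))).exists
    exact ⟨R', hR'U, hQ0 Q.1 Q.2 hQ1 hQ2 hR'⟩
  exact ⟨(hmem 1 one_pos).1, (hmem 1 one_pos).2.1,
    le_of_forall_pos_le_add fun ε hε => (hmem ε hε).2.2⟩
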